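/- Let $G$ and $H$ be locally compact second countable Hausdorff abelian groups and let $\mathcal L\subseteq G\times H$ be a discrete subgroup such that $\hat X:=(G\times H)/\mathcal L$ is compact. Assume that the projection $\pi^G:G\times H\to G$ is injective on $\mathcal L$ and that the projection of $\mathcal L$ to $H$ is dense in $H$. The group $G$ acts on $\hat X$ by $\hat T_g\hat x=(g,0)+\hat x$. Let $\mathcal M$ and $\mathcal M^G$ be the spaces of locally finite Borel measures on $G\times H$ and $G$, respectively, with the vague topology, and let $G$ act on $\mathcal M^G$ by $(S_g\nu)(A)=\nu(-g+A)$. For a compact set $W\subseteq H$ and $\hat x=x+\mathcal L\in\hat X$ put $\nu_W(\hat x)=\sum_{y\in(x+\mathcal L)\cap(G\times W)}\delta_y\in\mathcal M$ and $\nu_W^G(\hat x)=\pi^G_*(\nu_W(\hat x))\in\mathcal M^G$. Let $C_W\subseteq\hat X$ be the set of continuity points of the map $\nu_W:\hat X\to\mathcal M$, and let $\mathcal M_W^G$ be the closure of $\nu_W^G(\hat X)$ in $\mathcal M^G$. A subsystem of $(\mathcal M^G_W,S)$ is a non-empty closed $S$-invariant subset of $\mathcal M^G_W$; it is minimal if it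 contains no smaller subsystem. Let $W\subseteq H$ be compact with $\operatorname{int}(W)\neq\emptyset$ and suppose that the window $W':=\overline{\operatorname{int}(W)}$ is aperiodic, i.e. that $h+W'=W'$ with $h\in H$ implies $h=0$. Then $$M:=\overline{\nu_{W'}^G(C_{W'})}=\overline{\nu_W^G(C_W)}\subseteq\mathcal M_W^G ,$$ and the restriction of $S$ to $M$ is an almost automorphic extension of $(\hat X,\hat T)$: $M$ is compact, it is a minimal subsystem, and there is a continuous surjective map $\pi:M\to\hat X$ with $\pi\circ S_g=\hat T_g\circ\pi$ for all $g\in G$ such that $\pi^{-1}\{\hat x\}$ is a singleton for all $\hat x$ in some dense $G_\delta$-subset of $\hat X$. Moreover, $\pi$ can be chosen such that $\pi(\nu_W^G(\hat x))=\hat x$ for all $\hat x\in C_W$. Finally, $M$ is the only minimal subsystem of $(\mathcal M_W^G,S)$. -/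

import Mathlib

open MeasureTheory Set TopologicalSpace
open scoped Topology CompactlySupported

set_option linter.unusedSectionVars false

noncomputable section

/-- The space of all locally finite Borel measures on `X`. -/
def LFMeasure (X : Type*) [TopologicalSpace X] [MeasurableSpace X] : Type _ :=
  {μ : Measure X // IsLocallyFiniteMeasure μ}

/-- The vague topology: the coarsest topology for which `μ ↦ ∫ f dμ` is continuous for every
continuous real function `f` of compact support. -/
instance LFMeasure.instTopologicalSpace (X : Type*) [TopologicalSpace X] [MeasurableSpace X] :
    TopologicalSpace (LFMeasure X) :=
  TopologicalSpace.induced (fun (μ : LFMeasure X) (f : C_c(X, ℝ)) => ∫ x, f x ∂μ.1) inferInstance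

section ModelSets

variable {G H : Type*}
  [AddCommGroup G] [TopologicalSpace G] [IsTopologicalAddGroup G] [LocallyCompactSpace G]
  [T2Space G] [SecondCountableTopology G] [MeasurableSpace G] [BorelSpace G]
  [AddCommGroup H] [TopologicalSpace H] [IsTopologicalAddGroup H] [LocallyCompactSpace H]
  [T2Space H] [SecondCountableTopology H] [MeasurableSpace H] [BorelSpace H]

/-- The translation `T̂_g x̂ = (g, 0) + x̂` on `X̂ = (G × H) / L`. -/
def torusShift (L : AddSubgroup (G × H)) (g : G) (x : (G × H) ⧸ L) : (G × H) ⧸ L :=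
  QuotientAddGroup.mk ((g, 0) : G × H) + x

/-- The translation `(S_g ν)(A) = ν(-g + A)`. -/
def shiftMeasure (g : G) (ν : LFMeasure G) : LFMeasure G :=
  ⟨ν.1.map (fun x => g + x), by
    have := ν.2
    have : IsFiniteMeasureOnCompacts (ν.1.map (fun x => g + x)) := by
      refine ⟨fun K hK => ?_⟩
      rw [Measure.map_apply (measurable_const_add g) hK.measurableSet]
      exact ((Homeomorph.addLeft g).isCompact_preimage.2 hK).measure_lt_top
    exact isLocallyFiniteMeasure_of_isFiniteMeasureOnCompacts⟩

/-- The point set `(x + L) ∩ (G × W)`, where `x̂ = x + L`. -/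
def configSet (L : AddSubgroup (G × H)) (W : Set H) (x : (G × H) ⧸ L) : Set (G × H) :=
  {y | QuotientAddGroup.mk y = x ∧ y.2 ∈ W}

/-- The measure `∑ δ_y`, summed over `y ∈ (x + L) ∩ (G × W)`. -/
def configMeasure (L : AddSubgroup (G × H)) (W : Set H) (x : (G × H) ⧸ L) : Measure (G × H) :=
  Measure.sum fun y : configSet L W x => Measure.dirac y.1

theorem configSet_inter_finite (L : AddSubgroup (G × H)) [DiscreteTopology L] (W : Set H)
    (x : (G × H) ⧸ L) {K : Set (G × H)} (hK : IsCompact K) : (configSet L W x ∩ K).Finite := by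
  obtain ⟨z, rfl⟩ := QuotientAddGroup.mk_surjective x
  have hK' : IsCompact ((fun y => -z + y) '' K) := hK.image (continuous_const_add (-z))
  have hcl : IsClosed (L : Set (G × H)) := AddSubgroup.isClosed_of_discrete
  have hfin : ((fun y => -z + y) '' K ∩ L).Finite := by
    refine (hK'.inter_right hcl).finite ?_
    exact (isDiscrete_iff_discreteTopology.2 ‹_› : IsDiscrete (L : Set (G × H))).mono
      inter_subset_right
  refine (hfin.image (fun y => z + y)).subset ?_
  rintro y ⟨⟨hy, -⟩, hyK⟩
  exact ⟨-z + y, ⟨⟨y, hyK, rfl⟩, QuotientAddGroup.eq.1 hy.symm⟩, by simp⟩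

theorem configMeasure_lt_top (L : AddSubgroup (G × H)) [DiscreteTopology L] (W : Set H)
    (x : (G × H) ⧸ L) {A : Set (G × H)} (hA : MeasurableSet A)
    (h : (configSet L W x ∩ A).Finite) : configMeasure L W x A < ⊤ := by
  have h' : {y : configSet L W x | y.1 ∈ A}.Finite := by
    refine Set.Finite.of_finite_image (f := Subtype.val) (h.subset ?_) Subtype.val_injective.injOn
    rintro _ ⟨y, hy, rfl⟩
    exact ⟨y.2, hy⟩
  rw [configMeasure, Measure.sum_apply _ hA, tsum_eq_sum (s := h'.toFinset)]
  · refine ENNReal.sum_lt_top.2 fun y _ => ?_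
    exact measure_lt_top _ _
  · intro y hy
    have : y.1 ∉ A := by simpa using hy
    simp [Measure.dirac_apply' _ hA, this]

/-- The map `ν_W : X̂ → 𝓜`, `ν_W(x̂) = ∑ δ_y` over `y ∈ (x + L) ∩ (G × W)`. -/
def nuW (L : AddSubgroup (G × H)) [DiscreteTopology L] (W : Compacts H) (x : (G × H) ⧸ L) :
    LFMeasure (G × H) :=
  ⟨configMeasure L W x, by
    have : IsFiniteMeasureOnCompacts (configMeasure L (W : Set H) x) :=
      ⟨fun _ hK => configMeasure_lt_top L W x hK.measurableSet (configSet_inter_finite L W x hK)⟩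
    exact isLocallyFiniteMeasure_of_isFiniteMeasureOnCompacts⟩

/-- The map `ν_W^G : X̂ → 𝓜^G`, where `ν_W^G(x̂)` is the image of `ν_W(x̂)` under the
projection `G × H → G`. -/
def nuWG (L : AddSubgroup (G × H)) [DiscreteTopology L] (W : Compacts H) (x : (G × H) ⧸ L) :
    LFMeasure G :=
  ⟨(nuW L W x).1.map Prod.fst, by
    have : IsFiniteMeasureOnCompacts ((nuW L W x).1.map Prod.fst) := by
      refine ⟨fun K hK => ?_⟩
      rw [Measure.map_apply measurable_fst hK.measurableSet]
      refine configMeasure_lt_top L W x (measurable_fst hK.measurableSet) ?_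
      refine (configSet_inter_finite L W x (hK.prod W.isCompact)).subset ?_
      rintro y ⟨hy, hyK⟩
      exact ⟨hy, hyK, hy.2⟩
    exact isLocallyFiniteMeasure_of_isFiniteMeasureOnCompacts⟩

/-- The set `C_W` of all continuity points of `ν_W`. -/
def continuityPoints (L : AddSubgroup (G × H)) [DiscreteTopology L] (W : Compacts H) :
    Set ((G × H) ⧸ L) :=
  {x | ContinuousAt (nuW L W) x}

/-- The space `𝓜^G_W`, the vague closure of `ν_W^G(X̂)`. -/
def modelSpaceG (L : AddSubgroup (G × H)) [DiscreteTopology L] (W : Compacts H) :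
    Set (LFMeasure G) :=
  closure (range (nuWG L W))

end ModelSets

/-- The window `W' = closure (int W)`. -/
def regularPart {H : Type*} [TopologicalSpace H] [T2Space H] (W : Compacts H) : Compacts H :=
  ⟨closure (interior (W : Set H)), W.isCompact.closure_of_subset interior_subset⟩

/-- `W` is aperiodic: `h + W = W` implies `h = 0`. -/
def IsAperiodicWindow {H : Type*} [AddCommGroup H] (W : Set H) : Prop :=
  ∀ h : H, (fun w => h + w) '' W = W → h = 0

/-- `Y` is a subsystem for the maps `act g`: a non-empty closed invariant set. -/
structure IsSubsystem {Γ Z : Type*} [TopologicalSpace Z] (act : Γ → Z → Z) (Y : Set Z) :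
    Prop where
  nonempty : Y.Nonempty
  isClosed : IsClosed Y
  mapsTo : ∀ g, MapsTo (act g) Y Y

/-- `Y` is a minimal subsystem: a subsystem that contains no other subsystem. -/
structure IsMinimalSubsystem {Γ Z : Type*} [TopologicalSpace Z] (act : Γ → Z → Z) (Y : Set Z) :
    Prop where
  isSubsystem : IsSubsystem act Y
  eq_of_subset : ∀ Y' ⊆ Y, IsSubsystem act Y' → Y' = Y

/-- The compact system `Y` (with the maps `act g` restricted to it) is an almost automorphic
extension of the system `(X, actX)` via `π : Y → X`: it is minimal, `π` is a factor map
(continuous, onto, commuting with the actions), and `π` is almost 1-1, that is, the fibres over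
the points of some dense `G_δ`-subset of `X` are singletons. Only the values of `π` on `Y`
matter. -/
structure IsAlmostAutomorphicExtension {Γ Z X : Type*} [TopologicalSpace Z] [TopologicalSpace X]
    (act : Γ → Z → Z) (Y : Set Z) (actX : Γ → X → X) (π : Z → X) : Prop where
  isCompact : IsCompact Y
  isMinimal : IsMinimalSubsystem act Y
  continuousOn : ContinuousOn π Y
  surjOn : SurjOn π Y univ
  equivariant : ∀ g, ∀ y ∈ Y, π (act g y) = actX g (π y)
  almost_one_to_one : ∃ D : Set X, IsGδ D ∧ Dense D ∧ ∀ x ∈ D, ∃! y, y ∈ Y ∧ π y = x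

end

/-! Everything is read off from closures of graphs of `nuWG` in the product of X̂ with the measures
on G; they are compact because the integrals of each test function are uniformly bounded. Over a
continuity point such a closure contains only the value of `nuWG` there. Continuity points are the
x̂ for which no point of x + L lies over ∂W; by Baire they form a dense G_δ-set.

M lies in every subsystem Y (`closure_image_continuityPoints_subset`): the points x̂ paired with
some ν ∈ Y form a closed invariant set, hence all of X̂, and over a continuity point this puts
`nuWG` at x̂ into Y. Minimality and uniqueness follow.

The factor map exists because ν determines x̂ (`eq_of_mem_closure_graph`). If ν is paired with x̂₁
and x̂₂, each point of x₁ + L over int W shares its G-coordinate with a point of x₂ + L over W.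
Injectivity on L makes the H-displacement d constant; density gives d + W ⊆ W, by symmetry equality,
and aperiodicity d = 0. This is applied to W', whose measures agree with those of W on C_W. -/

open Filter

/-! ### The vague topology -/

namespace LFMeasure

theorem isInducing_integral (X : Type*) [TopologicalSpace X] [MeasurableSpace X] :
    Topology.IsInducing (fun (μ : LFMeasure X) (f : C_c(X, ℝ)) => ∫ x, f x ∂μ.1) :=
  ⟨rfl⟩

theorem continuous_integral {X : Type*} [TopologicalSpace X] [MeasurableSpace X] (f : C_c(X, ℝ)) :
    Continuous fun μ : LFMeasure X => ∫ x, f x ∂μ.1 :=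
  (continuous_apply f).comp (isInducing_integral X).continuous

theorem tendsto_iff {X α : Type*} [TopologicalSpace X] [MeasurableSpace X] {l : Filter α}
    {u : α → LFMeasure X} {μ : LFMeasure X} :
    Tendsto u l (𝓝 μ) ↔
      ∀ f : C_c(X, ℝ), Tendsto (fun a => ∫ x, f x ∂(u a).1) l (𝓝 (∫ x, f x ∂μ.1)) := by
  rw [(isInducing_integral X).tendsto_nhds_iff, tendsto_pi_nhds]
  rfl

variable {X : Type*} [TopologicalSpace X] [T2Space X] [LocallyCompactSpace X]
  [SecondCountableTopology X] [MeasurableSpace X] [BorelSpace X]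

theorem ext_of_integral_eq {μ ν : LFMeasure X}
    (h : ∀ f : C_c(X, ℝ), ∫ x, f x ∂μ.1 = ∫ x, f x ∂ν.1) : μ = ν := by
  have := μ.2
  have := ν.2
  exact Subtype.ext (Measure.ext_of_integral_eq_on_compactlySupported h)

instance instT2Space : T2Space (LFMeasure X) :=
  .of_injective_continuous (fun _ _ h => ext_of_integral_eq fun f => congrFun h f)
    (isInducing_integral X).continuous

theorem integrable (μ : LFMeasure X) (f : C_c(X, ℝ)) : Integrable f μ.1 := by
  have := μ.2
  exact f.continuous.integrable_of_hasCompactSupport f.hasCompactSupport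

/-- Every positive linear functional on `C_c(X, ℝ)` is integration against a locally finite
measure. -/
theorem exists_integral_eq (φ : C_c(X, ℝ) → ℝ) (hadd : ∀ f g, φ (f + g) = φ f + φ g)
    (hsmul : ∀ (c : ℝ) f, φ (c • f) = c * φ f) (hpos : ∀ f, 0 ≤ f → 0 ≤ φ f) :
    ∃ μ : LFMeasure X, ∀ f : C_c(X, ℝ), ∫ x, f x ∂μ.1 = φ f := by
  let Λ : C_c(X, ℝ) →ₚ[ℝ] ℝ :=
    PositiveLinearMap.mk₀ { toFun := φ, map_add' := hadd, map_smul' := hsmul } hpos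
  exact ⟨⟨RealRMK.rieszMeasure Λ, inferInstance⟩, RealRMK.integral_rieszMeasure Λ⟩

/-- Tychonoff plus Riesz: positivity and linearity are closed conditions on functionals, and every
functional satisfying them comes from a measure. -/
theorem isCompact_setOf_abs_integral_le (c : C_c(X, ℝ) → ℝ) :
    IsCompact {μ : LFMeasure X | ∀ f : C_c(X, ℝ), |∫ x, f x ∂μ.1| ≤ c f} := by
  rw [(isInducing_integral X).isCompact_iff]
  have hC : IsClosed {φ : C_c(X, ℝ) → ℝ | (∀ f g, φ (f + g) = φ f + φ g) ∧
      (∀ (c : ℝ) f, φ (c • f) = c * φ f) ∧ ∀ f, 0 ≤ f → 0 ≤ φ f} := by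
    simp only [ofPred_and, ofPred_forall]
    refine .inter ?_ (.inter ?_ ?_)
    · exact isClosed_iInter fun f => isClosed_iInter fun g =>
        isClosed_eq (by fun_prop) (by fun_prop)
    · exact isClosed_iInter fun f => isClosed_iInter fun g =>
        isClosed_eq (by fun_prop) (by fun_prop)
    · exact isClosed_iInter fun f => isClosed_iInter fun _ =>
        isClosed_le (by fun_prop) (by fun_prop)
  convert (isCompact_univ_pi fun f => isCompact_Icc (a := -c f) (b := c f)).inter_right hC
  ext φ
  constructor
  · rintro ⟨μ, hμ, rfl⟩
    refine ⟨fun f _ => abs_le.1 (hμ f), fun f g => ?_, fun a f => ?_, fun f hf => ?_⟩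
    · exact integral_add (μ.integrable f) (μ.integrable g)
    · exact integral_const_mul a _
    · exact integral_nonneg hf
  · rintro ⟨hb, hadd, hsmul, hpos⟩
    obtain ⟨μ, hμ⟩ := exists_integral_eq φ hadd hsmul hpos
    refine ⟨μ, fun f => ?_, funext hμ⟩
    rw [hμ]
    exact abs_le.2 (hb f trivial)

theorem isClosed_setOf_abs_integral_le (c : C_c(X, ℝ) → ℝ) :
    IsClosed {μ : LFMeasure X | ∀ f : C_c(X, ℝ), |∫ x, f x ∂μ.1| ≤ c f} :=
  (isCompact_setOf_abs_integral_le c).isClosed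

end LFMeasure

/-- A bump function at a point with support in a given neighbourhood. -/
theorem exists_compactlySupported_bump {X : Type*} [TopologicalSpace X] [T2Space X]
    [LocallyCompactSpace X] {x : X} {U : Set X} (hU : U ∈ 𝓝 x) :
    ∃ f : C_c(X, ℝ), f x = 1 ∧ (∀ y, 0 ≤ f y) ∧ ∀ y ∉ U, f y = 0 := by
  obtain ⟨V, hVU, hV, hxV⟩ := mem_nhds_iff.1 hU
  obtain ⟨f, hf1, hfc, hfV, hf01⟩ := exists_continuousMap_one_of_isCompact_subset_isOpen
    (isCompact_singleton (x := x)) hV (singleton_subset_iff.2 hxV)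
  exact ⟨⟨f, hfc⟩, hf1 rfl, fun y => (hf01 y).1,
    fun y hy => image_eq_zero_of_notMem_tsupport fun h => hy (hVU (hfV h))⟩

/-! ### Integrals against the configuration measures -/

section ModelSetIntegrals

variable {G H : Type*}
  [AddCommGroup G] [TopologicalSpace G] [IsTopologicalAddGroup G] [LocallyCompactSpace G]
  [T2Space G] [SecondCountableTopology G] [MeasurableSpace G] [BorelSpace G]
  [AddCommGroup H] [TopologicalSpace H] [IsTopologicalAddGroup H] [LocallyCompactSpace H]
  [T2Space H] [SecondCountableTopology H] [MeasurableSpace H] [BorelSpace H]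
  (L : AddSubgroup (G × H)) [DiscreteTopology L]

instance instT2SpaceQuotientOfDiscrete : T2Space ((G × H) ⧸ L) := by
  have : IsClosed (L : Set (G × H)) := AddSubgroup.isClosed_of_discrete
  infer_instance

theorem countable_lattice : Countable L :=
  countable_of_Lindelof_of_discrete

theorem finite_setOf_add_mem {Q K : Set (G × H)} (hQ : IsCompact Q) (hK : IsCompact K) :
    {l : L | ∃ z ∈ Q, z + l.1 ∈ K}.Finite := by
  have hcl : IsClosed (L : Set (G × H)) := AddSubgroup.isClosed_of_discrete
  have hfin : ((fun p : (G × H) × (G × H) => p.1 - p.2) '' K ×ˢ Q ∩ L).Finite := by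
    refine (((hK.prod hQ).image continuous_sub).inter_right hcl).finite ?_
    exact (isDiscrete_iff_discreteTopology.2 ‹_› : IsDiscrete (L : Set (G × H))).mono
      inter_subset_right
  refine .of_finite_image (f := Subtype.val) (hfin.subset ?_) Subtype.val_injective.injOn
  rintro _ ⟨l, ⟨z, hz, hl⟩, rfl⟩
  exact ⟨⟨(_, z), ⟨hl, hz⟩, by simp⟩, l.2⟩

theorem exists_isCompact_image_mk_eq_univ [CompactSpace ((G × H) ⧸ L)] :
    ∃ Q : Set (G × H), IsCompact Q ∧ (QuotientAddGroup.mk '' Q : Set ((G × H) ⧸ L)) = univ := by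
  choose K hK hKz using fun z : G × H => exists_compact_mem_nhds z
  obtain ⟨t, -, ht⟩ := (isCompact_univ (X := (G × H) ⧸ L)).elim_nhds_subcover
    (fun x => QuotientAddGroup.mk '' K x.out) fun x _ => by
      have := QuotientAddGroup.isOpenMap_coe (N := L) |>.image_mem_nhds (hKz x.out)
      rwa [QuotientAddGroup.out_eq'] at this
  refine ⟨⋃ x ∈ t, K x.out, t.isCompact_biUnion fun x _ => hK _, ?_⟩
  rw [image_iUnion₂]
  exact univ_subset_iff.1 ht

/-- Over a compact set, the periodization of a compactly supported function is a finite sum. -/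
theorem exists_finset_tsum_eq {F : G × H → ℝ} {K Q : Set (G × H)} (hK : IsCompact K)
    (hF : ∀ y ∉ K, F y = 0) (hQ : IsCompact Q) :
    ∃ s : Finset L, ∀ z ∈ Q, ∑' l : L, F (z + l.1) = ∑ l ∈ s, F (z + l.1) := by
  refine ⟨(finite_setOf_add_mem L hQ hK).toFinset, fun z hz => tsum_eq_sum fun l hl => hF _ ?_⟩
  intro h
  exact hl ((Finite.mem_toFinset _).2 ⟨z, hz, h⟩)

variable (W : Compacts H)

/-- Lifting x̂ to z makes the index set independent of the point, so the dependence on z can be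
studied term by term. -/
theorem integral_nuW_mk (f : C_c(G × H, ℝ)) (z : G × H) :
    ∫ y, f y ∂(nuW L W (QuotientAddGroup.mk z)).1 =
      ∑' l : L, (Prod.snd ⁻¹' (W : Set H)).indicator f (z + l.1) := by
  have hf := (nuW L W (QuotientAddGroup.mk z)).integrable f
  change ∫ y, f y ∂(Measure.sum fun y : configSet L W (QuotientAddGroup.mk z) =>
    Measure.dirac y.1) = _
  rw [integral_sum_measure hf]
  simp only [integral_dirac]
  rw [_root_.tsum_subtype (configSet L W (QuotientAddGroup.mk z)) f]
  have hinj : Function.Injective fun l : L => z + l.1 := fun a b h =>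
    Subtype.ext (add_left_cancel h)
  rw [← hinj.tsum_eq]
  · refine tsum_congr fun l => ?_
    have : (QuotientAddGroup.mk (z + l.1) : (G × H) ⧸ L) = QuotientAddGroup.mk z :=
      QuotientAddGroup.mk_add_of_mem z l.2
    by_cases h : (z + l.1).2 ∈ W
    · rw [indicator_of_mem (show z + l.1 ∈ configSet L W _ from ⟨this, h⟩),
        indicator_of_mem (show z + l.1 ∈ Prod.snd ⁻¹' (W : Set H) from h)]
    · rw [indicator_of_notMem fun h' => h h'.2,
        indicator_of_notMem (show z + l.1 ∉ Prod.snd ⁻¹' (W : Set H) from h)]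
  · intro y hy
    have hy' : y ∈ configSet L W (QuotientAddGroup.mk z) := by
      by_contra h
      exact hy (indicator_of_notMem h _)
    exact ⟨⟨-z + y, QuotientAddGroup.eq.1 hy'.1.symm⟩, by simp⟩

theorem ae_nuW (x : (G × H) ⧸ L) : ∀ᵐ y ∂(nuW L W x).1, y ∈ configSet L W x := by
  have hm : MeasurableSet (configSet L W x) := by
    have h1 : IsClosed {y : G × H | (QuotientAddGroup.mk y : (G × H) ⧸ L) = x} :=
      isClosed_eq QuotientAddGroup.continuous_mk continuous_const
    exact (h1.inter (W.isCompact.isClosed.preimage continuous_snd)).measurableSet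
  rw [ae_iff]
  change (Measure.sum fun y : configSet L W x => Measure.dirac y.1) (configSet L W x)ᶜ = 0
  rw [Measure.sum_apply _ hm.compl]
  simp [Measure.dirac_apply' _ hm.compl]

theorem integral_nuWG (f : C_c(G, ℝ)) (x : (G × H) ⧸ L) :
    ∫ g, f g ∂(nuWG L W x).1 = ∫ y, f y.1 ∂(nuW L W x).1 :=
  integral_map measurable_fst.aemeasurable f.continuous.aestronglyMeasurable

/-- A function on `G` extends to a compactly supported function on `G × H` that depends on the first
coordinate only as long as the second one is in `W`. -/
theorem exists_extension (f : C_c(G, ℝ)) :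
    ∃ F : C_c(G × H, ℝ), ∀ y : G × H, y.2 ∈ W → F y = f y.1 := by
  obtain ⟨φ, hφ1, hφc, -⟩ := exists_continuousMap_one_of_isCompact_subset_isOpen
    W.isCompact isOpen_univ (subset_univ _)
  refine ⟨⟨⟨fun y => f y.1 * φ y.2, by fun_prop⟩, ?_⟩, fun y hy => ?_⟩
  · refine HasCompactSupport.intro (f.hasCompactSupport.isCompact.prod hφc) fun y hy => ?_
    change f y.1 * φ y.2 = 0
    by_cases h : y.1 ∈ tsupport f
    · rw [image_eq_zero_of_notMem_tsupport fun h' => hy ⟨h, h'⟩, mul_zero]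
    · rw [image_eq_zero_of_notMem_tsupport h, zero_mul]
  · change f y.1 * φ y.2 = f y.1
    rw [hφ1 hy, Pi.one_apply, mul_one]

theorem integral_nuWG_eq {f : C_c(G, ℝ)} {F : C_c(G × H, ℝ)}
    (hF : ∀ y : G × H, y.2 ∈ W → F y = f y.1) (x : (G × H) ⧸ L) :
    ∫ g, f g ∂(nuWG L W x).1 = ∫ y, F y ∂(nuW L W x).1 := by
  rw [integral_nuWG]
  refine integral_congr_ae ?_
  filter_upwards [ae_nuW L W x] with y hy
  exact (hF y hy.2).symm

theorem integral_nuWG_eq_zero {f : C_c(G, ℝ)} {x : (G × H) ⧸ L}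
    (h : ∀ y ∈ configSet L W x, f y.1 = 0) : ∫ g, f g ∂(nuWG L W x).1 = 0 := by
  rw [integral_nuWG]
  refine integral_eq_zero_of_ae ?_
  filter_upwards [ae_nuW L W x] with y hy using h y hy

theorem le_integral_nuW {F : C_c(G × H, ℝ)} {x : (G × H) ⧸ L} (h0 : ∀ y, y.2 ∈ W → 0 ≤ F y)
    {y : G × H} (hy : y ∈ configSet L W x) : F y ≤ ∫ y, F y ∂(nuW L W x).1 := by
  obtain ⟨hx, hyW⟩ := hy
  subst hx
  rw [integral_nuW_mk]
  set F' := (Prod.snd ⁻¹' (W : Set H)).indicator F with hF'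
  have hsupp : ∀ y ∉ tsupport F, F' y = 0 := fun y hy =>
    indicator_apply_eq_zero.2 fun _ => image_eq_zero_of_notMem_tsupport hy
  have hnn : ∀ y, 0 ≤ F' y := fun y => indicator_nonneg h0 y
  have hsum : Summable fun l : L => F' (y + l.1) := by
    refine summable_of_ne_finset_zero (s := (finite_setOf_add_mem L
      (isCompact_singleton (x := y)) F.hasCompactSupport.isCompact).toFinset) fun l hl => ?_
    exact hsupp _ fun h => hl ((Finite.mem_toFinset _).2 ⟨y, rfl, h⟩)
  calc F y = F' (y + (0 : L).1) := by simp [hF', indicator_of_mem, hyW]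
    _ ≤ _ := hsum.le_tsum 0 fun l _ => hnn _

theorem le_integral_nuWG {f : C_c(G, ℝ)} {x : (G × H) ⧸ L} (h0 : ∀ g, 0 ≤ f g)
    {y : G × H} (hy : y ∈ configSet L W x) : f y.1 ≤ ∫ g, f g ∂(nuWG L W x).1 := by
  obtain ⟨F, hF⟩ := exists_extension W f
  rw [integral_nuWG_eq L W hF, ← hF y hy.2]
  exact le_integral_nuW L W (fun y hy => by rw [hF y hy]; exact h0 _) hy

/-- Representatives can be taken in one compact set, over which only finitely many fixed lattice
vectors contribute. -/
theorem exists_abs_integral_nuWG_le [CompactSpace ((G × H) ⧸ L)] (f : C_c(G, ℝ)) :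
    ∃ C : ℝ, ∀ x, |∫ g, f g ∂(nuWG L W x).1| ≤ C := by
  obtain ⟨F, hF⟩ := exists_extension W f
  obtain ⟨Q, hQ, hQu⟩ := exists_isCompact_image_mk_eq_univ L
  have hsupp : ∀ y ∉ tsupport F, (Prod.snd ⁻¹' (W : Set H)).indicator F y = 0 := fun y hy =>
    indicator_apply_eq_zero.2 fun _ => image_eq_zero_of_notMem_tsupport hy
  obtain ⟨s, hs⟩ := exists_finset_tsum_eq L F.hasCompactSupport.isCompact hsupp hQ
  obtain ⟨C, hC⟩ := F.hasCompactSupport.exists_bound_of_continuous F.continuous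
  refine ⟨∑ _l ∈ s, C, fun x => ?_⟩
  obtain ⟨z, hz, rfl⟩ : x ∈ (QuotientAddGroup.mk '' Q : Set ((G × H) ⧸ L)) := hQu ▸ mem_univ x
  rw [integral_nuWG_eq L W hF, integral_nuW_mk, hs z hz]
  refine (Finset.abs_sum_le_sum_abs _ _).trans (Finset.sum_le_sum fun l _ => ?_)
  exact (norm_indicator_le_norm_self F _).trans (hC _)

theorem isCompact_modelSpaceG [CompactSpace ((G × H) ⧸ L)] : IsCompact (modelSpaceG L W) := by
  choose c hc using exists_abs_integral_nuWG_le L W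
  refine (LFMeasure.isCompact_setOf_abs_integral_le c).of_isClosed_subset isClosed_closure
    (closure_minimal ?_ (LFMeasure.isClosed_setOf_abs_integral_le c))
  rintro _ ⟨x, rfl⟩ f
  exact hc f x

theorem continuousAt_nuWG {x : (G × H) ⧸ L} (hx : x ∈ continuityPoints L W) :
    ContinuousAt (nuWG L W) x := by
  refine LFMeasure.tendsto_iff.2 fun f => ?_
  obtain ⟨F, hF⟩ := exists_extension W f
  simp only [integral_nuWG_eq L W hF]
  exact LFMeasure.tendsto_iff.1 hx F

end ModelSetIntegrals

/-! ### Continuity points and the regular part of the window -/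

section ContinuityPoints

variable {G H : Type*}
  [AddCommGroup G] [TopologicalSpace G] [IsTopologicalAddGroup G] [LocallyCompactSpace G]
  [T2Space G] [SecondCountableTopology G] [MeasurableSpace G] [BorelSpace G]
  [AddCommGroup H] [TopologicalSpace H] [IsTopologicalAddGroup H] [LocallyCompactSpace H]
  [T2Space H] [SecondCountableTopology H] [MeasurableSpace H] [BorelSpace H]
  (L : AddSubgroup (G × H)) [DiscreteTopology L] (W : Compacts H)

theorem continuousAt_indicator_of_notMem_frontier {X : Type*} [TopologicalSpace X] {f : X → ℝ}
    {S : Set X} {x : X} (hf : ContinuousAt f x) (hx : x ∉ frontier S) :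
    ContinuousAt (S.indicator f) x := by
  by_cases h : x ∈ interior S
  · refine hf.congr ?_
    filter_upwards [mem_interior_iff_mem_nhds.1 h] with y hy
    exact (indicator_of_mem hy f).symm
  · have h' : x ∈ interior Sᶜ := by
      rw [interior_compl]
      exact fun hc => hx ⟨hc, h⟩
    refine (continuousAt_const (y := (0 : ℝ))).congr ?_
    filter_upwards [mem_interior_iff_mem_nhds.1 h'] with y hy
    exact (indicator_of_notMem hy f).symm

theorem continuousAt_nuW {x : (G × H) ⧸ L}
    (hx : ∀ y : G × H, QuotientAddGroup.mk y = x → y.2 ∉ frontier (W : Set H)) :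
    ContinuousAt (nuW L W) x := by
  obtain ⟨z, rfl⟩ := QuotientAddGroup.mk_surjective x
  rw [← QuotientAddGroup.isOpenQuotientMap_mk.continuousAt_comp_iff]
  refine LFMeasure.tendsto_iff.2 fun f => ?_
  obtain ⟨Q, hQ, hzQ⟩ := exists_compact_mem_nhds z
  have hsupp : ∀ y ∉ tsupport f, (Prod.snd ⁻¹' (W : Set H)).indicator f y = 0 := fun y hy =>
    indicator_apply_eq_zero.2 fun _ => image_eq_zero_of_notMem_tsupport hy
  obtain ⟨s, hs⟩ := exists_finset_tsum_eq L f.hasCompactSupport.isCompact hsupp hQ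
  simp only [Function.comp_apply, integral_nuW_mk]
  rw [hs z (mem_of_mem_nhds hzQ)]
  refine Tendsto.congr' (f₁ := fun z' => ∑ l ∈ s, (Prod.snd ⁻¹' (W : Set H)).indicator f (z' + l.1))
    ?_ (tendsto_finsetSum _ fun l _ => ?_)
  · filter_upwards [hzQ] with z' hz' using (hs z' hz').symm
  · have hl : z + l.1 ∉ frontier (Prod.snd ⁻¹' (W : Set H) : Set (G × H)) := by
      rw [← isOpenMap_snd.preimage_frontier_eq_frontier_preimage continuous_snd]
      exact hx _ (QuotientAddGroup.mk_add_of_mem z l.2)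
    exact (continuousAt_indicator_of_notMem_frontier f.continuous.continuousAt hl).tendsto.comp
      (f := fun z' => z' + l.1) (continuous_add_const l.1).continuousAt

/-- Near any point, translates of the lattice have at most one point. -/
theorem exists_nhds_zero_sub_eq_zero :
    ∃ V ∈ 𝓝 (0 : G × H), ∀ a ∈ V, ∀ b ∈ V, a - b ∈ L → a - b = 0 := by
  obtain ⟨U, hU, hUL⟩ := isOpen_induced_iff.1 (isOpen_discrete ({0} : Set L))
  have h0 : (0 : G × H) ∈ U := by
    have : (0 : L) ∈ Subtype.val ⁻¹' U := hUL ▸ rfl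
    exact this
  obtain ⟨V, hV, hVU⟩ := exists_nhds_half_neg (hU.mem_nhds h0)
  refine ⟨V, hV, fun a ha b hb hab => ?_⟩
  have : (⟨a - b, hab⟩ : L) ∈ Subtype.val ⁻¹' U := hVU a ha b hb
  rw [hUL] at this
  exact congrArg Subtype.val this

/-- A point over ∂W can be pushed out of W by an arbitrarily small move in H, and its mass then
disappears from a small neighbourhood. -/
theorem notMem_frontier_of_mem_continuityPoints {x : (G × H) ⧸ L}
    (hx : x ∈ continuityPoints L W) {y : G × H} (hy : QuotientAddGroup.mk y = x) :
    y.2 ∉ frontier (W : Set H) := by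
  subst hy
  intro hfr
  obtain ⟨V, hV, hVL⟩ := exists_nhds_zero_sub_eq_zero L
  have hV' : ∀ᶠ z in 𝓝 y, z - y ∈ V :=
    (continuous_sub_right y).continuousAt.eventually (by simpa using hV)
  obtain ⟨f, hfy, hf0, hfV⟩ := exists_compactlySupported_bump hV'
  have hyW : y.2 ∈ (W : Set H) := W.isCompact.isClosed.frontier_subset hfr
  have h1 : 0 < ∫ w, f w ∂(nuW L W (QuotientAddGroup.mk y)).1 :=
    lt_of_lt_of_le (by rw [hfy]; exact one_pos) (le_integral_nuW L W (fun w _ => hf0 w) ⟨rfl, hyW⟩)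
  have h2 : ∀ᶠ z in 𝓝 y, 0 < ∫ w, f w ∂(nuW L W (QuotientAddGroup.mk z)).1 :=
    (QuotientAddGroup.continuous_mk (N := L)).continuousAt.eventually
      ((LFMeasure.tendsto_iff.1 hx f).eventually (lt_mem_nhds h1))
  have h3 : Tendsto (fun h : H => (y.1, h)) (𝓝 y.2) (𝓝 y) :=
    (Continuous.prodMk_right y.1).continuousAt
  have h4 : ∃ᶠ h in 𝓝 y.2, h ∈ (W : Set H)ᶜ := by
    rw [← mem_closure_iff_frequently]
    rw [frontier_eq_closure_inter_closure] at hfr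
    exact hfr.2
  obtain ⟨h, hW, hpos, hV⟩ := (h4.and_eventually (h3.eventually (h2.and hV'))).exists
  refine hpos.ne' ?_
  rw [integral_nuW_mk]
  convert tsum_zero with l
  refine indicator_apply_eq_zero.2 fun hl => ?_
  by_contra hne
  -- A nonzero term puts both (y.1, h) and its translate by l near y; this forces l = 0, yet h ∉ W.
  have hlV : (y.1, h) + l.1 - y ∈ V := by
    by_contra hc
    exact hne (hfV _ hc)
  have hsub : (y.1, h) + l.1 - y - ((y.1, h) - y) = l.1 := by abel
  have hl0 := hVL _ hlV _ hV (by rw [hsub]; exact l.2)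
  rw [hsub] at hl0
  rw [hl0, add_zero] at hl
  exact hW hl

theorem mem_continuityPoints_iff {x : (G × H) ⧸ L} :
    x ∈ continuityPoints L W ↔
      ∀ y : G × H, QuotientAddGroup.mk y = x → y.2 ∉ frontier (W : Set H) :=
  ⟨fun hx _ hy => notMem_frontier_of_mem_continuityPoints L W hx hy, continuousAt_nuW L W⟩

/-- G is σ-compact, so the image of G × ∂W in X̂ is a countable union of compact sets. -/
theorem isGδ_continuityPoints : IsGδ (continuityPoints L W) := by
  have : continuityPoints L W = ⋂ n : ℕ, ((QuotientAddGroup.mk ''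
      (compactCovering G n ×ˢ frontier (W : Set H)) : Set ((G × H) ⧸ L)))ᶜ := by
    ext x
    rw [mem_continuityPoints_iff, mem_iInter]
    constructor
    · rintro hx n ⟨y, hy, hyx⟩
      exact hx y hyx hy.2
    · intro hx y hyx hy
      obtain ⟨n, hn⟩ := mem_iUnion.1 (iUnion_compactCovering G ▸ mem_univ y.1)
      exact hx n ⟨y, ⟨hn, hy⟩, hyx⟩
  rw [this]
  have hfr : IsCompact (frontier (W : Set H)) :=
    W.isCompact.of_isClosed_subset isClosed_frontier W.isCompact.isClosed.frontier_subset
  exact .iInter_of_isOpen fun n => (((isCompact_compactCovering G n).prod hfr).image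
    QuotientAddGroup.continuous_mk).isClosed.isOpen_compl

/-- Baire in H: the countably many translates of ∂W by the H-coordinates of L are closed and nowhere
dense. -/
theorem dense_continuityPoints : Dense (continuityPoints L W) := by
  have := countable_lattice L
  have hd : Dense (⋂ l : L, (fun h : H => h + l.1.2) ⁻¹' (frontier (W : Set H))ᶜ) := by
    refine dense_iInter_of_isOpen (fun l => isClosed_frontier.isOpen_compl.preimage
      (continuous_add_const _)) fun l => ?_
    refine Dense.preimage ?_ (Homeomorph.addRight l.1.2).isOpenMap
    rw [← interior_eq_empty_iff_dense_compl]
    exact interior_frontier W.isCompact.isClosed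
  refine (QuotientAddGroup.mk_surjective.denseRange.dense_image
    (QuotientAddGroup.continuous_mk (N := L)) (hd.preimage isOpenMap_snd)).mono ?_
  rintro _ ⟨z, hz, rfl⟩
  rw [mem_continuityPoints_iff]
  intro y hy
  have := mem_iInter.1 hz ⟨-z + y, QuotientAddGroup.eq.1 hy.symm⟩
  simpa using this

theorem torusShift_mem_continuityPoints (g : G) {x : (G × H) ⧸ L}
    (hx : x ∈ continuityPoints L W) : torusShift L g x ∈ continuityPoints L W := by
  rw [mem_continuityPoints_iff] at hx ⊢
  intro y hy
  have := hx (-(g, 0) + y) (by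
    rw [QuotientAddGroup.mk_add, hy, torusShift, QuotientAddGroup.mk_neg, neg_add_cancel_left])
  simpa using this

theorem regularPart_subset : (regularPart W : Set H) ⊆ W :=
  closure_minimal interior_subset W.isCompact.isClosed

theorem interior_regularPart : interior (regularPart W : Set H) = interior (W : Set H) :=
  (interior_mono (regularPart_subset W)).antisymm
    (interior_maximal subset_closure isOpen_interior)

theorem continuityPoints_subset_regularPart :
    continuityPoints L W ⊆ continuityPoints L (regularPart W) := by
  intro x hx
  rw [mem_continuityPoints_iff] at hx ⊢
  intro y hy hfr
  refine hx y hy ⟨closure_mono (regularPart_subset W) hfr.1, ?_⟩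
  rw [← interior_regularPart]
  exact hfr.2

/-- The windows differ only inside ∂W, over which x + L has no points. -/
theorem nuWG_regularPart {x : (G × H) ⧸ L} (hx : x ∈ continuityPoints L W) :
    nuWG L (regularPart W) x = nuWG L W x := by
  have h : configSet L (regularPart W : Set H) x = configSet L (W : Set H) x := by
    ext y
    refine ⟨fun hy => ⟨hy.1, regularPart_subset W hy.2⟩, fun hy => ⟨hy.1, ?_⟩⟩
    by_contra hc
    exact (mem_continuityPoints_iff L W).1 hx y hy.1
      ⟨subset_closure hy.2, fun hi => hc (subset_closure hi)⟩
  refine Subtype.ext (congrArg (Measure.map Prod.fst) ?_)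
  exact congrArg (fun S : Set (G × H) => Measure.sum fun y : S => Measure.dirac y.1) h

end ContinuityPoints

/-- The translate `x ↦ f (a + x)`. -/
noncomputable def translateCc {A : Type*} [AddCommGroup A] [TopologicalSpace A]
    [IsTopologicalAddGroup A] (a : A) (f : C_c(A, ℝ)) : C_c(A, ℝ) :=
  ⟨⟨fun x => f (a + x), by fun_prop⟩, f.hasCompactSupport.comp_homeomorph (Homeomorph.addLeft a)⟩

/-! ### Equivariance and limits of the graph -/

section Dynamics

variable {G H : Type*}
  [AddCommGroup G] [TopologicalSpace G] [IsTopologicalAddGroup G] [LocallyCompactSpace G]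
  [T2Space G] [SecondCountableTopology G] [MeasurableSpace G] [BorelSpace G]
  [AddCommGroup H] [TopologicalSpace H] [IsTopologicalAddGroup H] [LocallyCompactSpace H]
  [T2Space H] [SecondCountableTopology H] [MeasurableSpace H] [BorelSpace H]
  (L : AddSubgroup (G × H)) [DiscreteTopology L] (W : Compacts H)

theorem integral_shiftMeasure (g : G) (ν : LFMeasure G) (f : C_c(G, ℝ)) :
    ∫ x, f x ∂(shiftMeasure g ν).1 = ∫ x, translateCc g f x ∂ν.1 :=
  integral_map (measurable_const_add g).aemeasurable f.continuous.aestronglyMeasurable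

theorem continuous_shiftMeasure (g : G) : Continuous (shiftMeasure g) := by
  refine (LFMeasure.isInducing_integral G).continuous_iff.2 (continuous_pi fun f => ?_)
  exact (LFMeasure.continuous_integral (translateCc g f)).congr
    fun ν => (integral_shiftMeasure g ν f).symm

theorem shiftMeasure_nuWG (g : G) (x : (G × H) ⧸ L) :
    shiftMeasure g (nuWG L W x) = nuWG L W (torusShift L g x) := by
  refine LFMeasure.ext_of_integral_eq fun f => ?_
  obtain ⟨F, hF⟩ := exists_extension W f
  have hF' : ∀ y : G × H, y.2 ∈ W →
      translateCc ((g, 0) : G × H) F y = translateCc g f y.1 := fun y hy =>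
    hF ((g, 0) + y) (by simpa using hy)
  rw [integral_shiftMeasure, integral_nuWG_eq L W hF', integral_nuWG_eq L W hF]
  obtain ⟨z, rfl⟩ := QuotientAddGroup.mk_surjective x
  rw [torusShift, ← QuotientAddGroup.mk_add, integral_nuW_mk, integral_nuW_mk]
  refine tsum_congr fun l => ?_
  have h2 : ((g, 0) + z + l.1).2 = (z + l.1).2 := by simp
  by_cases h : (z + l.1).2 ∈ (W : Set H)
  · rw [indicator_of_mem (show z + l.1 ∈ Prod.snd ⁻¹' (W : Set H) from h),
      indicator_of_mem (show (g, 0) + z + l.1 ∈ Prod.snd ⁻¹' (W : Set H) by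
        rwa [mem_preimage, h2]), add_assoc]
    rfl
  · rw [indicator_of_notMem (show z + l.1 ∉ Prod.snd ⁻¹' (W : Set H) from h),
      indicator_of_notMem
        (show (g, 0) + z + l.1 ∉ Prod.snd ⁻¹' (W : Set H) by
        rwa [mem_preimage, h2])]

theorem continuous_torusShift (g : G) : Continuous (torusShift L g) :=
  continuous_const_add _

/-- The graph of `ν_W^G` over a set `S`. -/
def nuWGGraph (S : Set ((G × H) ⧸ L)) : Set (((G × H) ⧸ L) × LFMeasure G) :=
  (fun x => (x, nuWG L W x)) '' S

variable {L W} {S : Set ((G × H) ⧸ L)} {x : (G × H) ⧸ L} {ν : LFMeasure G}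

theorem integral_mem_of_mem_closure_graph (h : (x, ν) ∈ closure (nuWGGraph L W S))
    {f : C_c(G, ℝ)} {C : Set ℝ} (hC : IsClosed C)
    (hev : ∀ᶠ x' in 𝓝 x, ∫ g, f g ∂(nuWG L W x').1 ∈ C) : ∫ g, f g ∂ν.1 ∈ C := by
  by_contra hν
  have h1 : ∀ᶠ ν' in 𝓝 ν, ∫ g, f g ∂ν'.1 ∈ Cᶜ :=
    (LFMeasure.continuous_integral f).continuousAt.eventually (hC.isOpen_compl.mem_nhds hν)
  obtain ⟨_, ⟨x', -, rfl⟩, hx', hν'⟩ :=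
    ((mem_closure_iff_frequently.1 h).and_eventually (hev.prod_nhds h1)).exists
  exact hν' hx'

theorem eq_nuWG_of_mem_closure_graph (h : (x, ν) ∈ closure (nuWGGraph L W S))
    (hx : x ∈ continuityPoints L W) : ν = nuWG L W x := by
  refine LFMeasure.ext_of_integral_eq fun f => eq_of_forall_dist_le fun ε hε => ?_
  exact integral_mem_of_mem_closure_graph h Metric.isClosed_closedBall
    ((LFMeasure.tendsto_iff.1 (continuousAt_nuWG L W hx) f).eventually
      (Metric.closedBall_mem_nhds _ hε))

/-- Points over the open set int W persist under small perturbations of x̂; any constant below 1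
would do. -/
theorem half_le_integral_of_mem_closure_graph (h : (x, ν) ∈ closure (nuWGGraph L W S))
    {y : G × H} (hy : QuotientAddGroup.mk y = x) (hyW : y.2 ∈ interior (W : Set H))
    {f : C_c(G, ℝ)} (hf0 : ∀ g, 0 ≤ f g) (hf1 : f y.1 = 1) : 1 / 2 ≤ ∫ g, f g ∂ν.1 := by
  refine integral_mem_of_mem_closure_graph h isClosed_Ici (C := Ici (1 / 2)) ?_
  have hO : IsOpen ((f ⁻¹' Ioi (1 / 2)) ×ˢ interior (W : Set H)) :=
    (isOpen_Ioi.preimage f.continuous).prod isOpen_interior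
  have hyO : y ∈ (f ⁻¹' Ioi (1 / 2)) ×ˢ interior (W : Set H) :=
    ⟨by rw [mem_preimage, hf1]; norm_num, hyW⟩
  have hn := (QuotientAddGroup.isOpenMap_coe (N := L)).image_mem_nhds (hO.mem_nhds hyO)
  rw [hy] at hn
  filter_upwards [hn]
  rintro _ ⟨w, ⟨hw1, hw2⟩, rfl⟩
  exact (le_of_lt hw1).trans (le_integral_nuWG L W hf0 ⟨rfl, interior_subset hw2⟩)

/-- By local finiteness x + L misses U × W for a compact neighbourhood U of g, and this remains true
for all nearby x̂. -/
theorem exists_nhds_integral_eq_zero_of_mem_closure_graph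
    (h : (x, ν) ∈ closure (nuWGGraph L W S)) {g : G}
    (hg : ∀ y ∈ configSet L (W : Set H) x, y.1 ≠ g) :
    ∃ U ∈ 𝓝 g, ∀ f : C_c(G, ℝ), (∀ g ∉ U, f g = 0) → ∫ g, f g ∂ν.1 = 0 := by
  obtain ⟨N, hN, hgN⟩ := exists_compact_mem_nhds g
  have hfin := (configSet_inter_finite L (W : Set H) x (hN.prod W.isCompact)).image Prod.fst
  have hg' : g ∉ Prod.fst '' (configSet L (W : Set H) x ∩ N ×ˢ (W : Set H)) := by
    rintro ⟨y, ⟨hy, -⟩, rfl⟩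
    exact hg y hy rfl
  obtain ⟨U, hU, hUN, hUc⟩ := local_compact_nhds
    (inter_mem hgN (hfin.isClosed.isOpen_compl.mem_nhds hg'))
  refine ⟨U, hU, fun f hf => ?_⟩
  refine integral_mem_of_mem_closure_graph h isClosed_singleton (C := {0}) ?_
  have hcl : IsClosed (QuotientAddGroup.mk '' (U ×ˢ (W : Set H)) : Set ((G × H) ⧸ L)) :=
    ((hUc.prod W.isCompact).image QuotientAddGroup.continuous_mk).isClosed
  have hx : x ∉ (QuotientAddGroup.mk '' (U ×ˢ (W : Set H)) : Set ((G × H) ⧸ L)) := by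
    rintro ⟨y, ⟨hyU, hyW⟩, hyx⟩
    exact (hUN hyU).2 ⟨y, ⟨⟨hyx, hyW⟩, (hUN hyU).1, hyW⟩, rfl⟩
  filter_upwards [hcl.isOpen_compl.mem_nhds hx] with x' hx'
  refine integral_nuWG_eq_zero L W fun y hy => hf _ fun hyU => ?_
  exact hx' ⟨y, ⟨hyU, hy.2⟩, hy.1⟩

theorem exists_mem_configSet_of_mem_closure_graph {x₁ x₂ : (G × H) ⧸ L}
    (h₁ : (x₁, ν) ∈ closure (nuWGGraph L W S)) (h₂ : (x₂, ν) ∈ closure (nuWGGraph L W S))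
    {y : G × H} (hy : QuotientAddGroup.mk y = x₁) (hyW : y.2 ∈ interior (W : Set H)) :
    ∃ y' ∈ configSet L (W : Set H) x₂, y'.1 = y.1 := by
  by_contra! hc
  obtain ⟨U, hU, hUf⟩ := exists_nhds_integral_eq_zero_of_mem_closure_graph h₂ hc
  obtain ⟨f, hf1, hf0, hfU⟩ := exists_compactlySupported_bump hU
  have := half_le_integral_of_mem_closure_graph h₁ hy hyW hf0 hf1
  rw [hUf f hfU] at this
  norm_num at this

/-- The inclusion is checked on the points of int W that are H-coordinates of y₁ + L; these are
dense in W, and W is closed. -/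
theorem add_mem_window_of_mem_closure_graph (hG : InjOn Prod.fst (L : Set (G × H)))
    (hH : Dense (Prod.snd '' (L : Set (G × H))))
    (hW : closure (interior (W : Set H)) = W) {y₁ y₂ : G × H} (hy : y₁.1 = y₂.1)
    (h₁ : (QuotientAddGroup.mk y₁, ν) ∈ closure (nuWGGraph L W S))
    (h₂ : (QuotientAddGroup.mk y₂, ν) ∈ closure (nuWGGraph L W S))
    {w : H} (hw : w ∈ (W : Set H)) : y₂.2 - y₁.2 + w ∈ (W : Set H) := by
  have hd : Dense ((fun h => y₁.2 + h) '' (Prod.snd '' (L : Set (G × H)))) :=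
    (Homeomorph.addLeft y₁.2).surjective.denseRange.dense_image (continuous_const_add _) hH
  have hcl : IsClosed {w : H | y₂.2 - y₁.2 + w ∈ (W : Set H)} :=
    W.isCompact.isClosed.preimage (continuous_const_add _)
  rw [← hW] at hw
  refine closure_minimal ((hd.open_subset_closure_inter isOpen_interior).trans
    (closure_minimal ?_ hcl)) hcl hw
  rintro _ ⟨hi, _, ⟨l, hl, rfl⟩, rfl⟩
  obtain ⟨y', ⟨hy', hyW⟩, hfst⟩ := exists_mem_configSet_of_mem_closure_graph h₁ h₂
    (y := y₁ + l) (QuotientAddGroup.mk_add_of_mem y₁ hl) hi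
  have hl' : -y₂ + y' ∈ L := QuotientAddGroup.eq.1 hy'.symm
  -- Injectivity on L identifies the partner of y₁ + l as y₂ + l, so the H-displacement is the same
  -- for every l.
  have : -y₂ + y' = l := hG hl' hl (by simp [hfst, hy])
  have h2 : y'.2 = y₂.2 + l.2 := by
    rw [← this]
    simp
  change y₂.2 - y₁.2 + (y₁.2 + l.2) ∈ (W : Set H)
  rw [show y₂.2 - y₁.2 + (y₁.2 + l.2) = y'.2 by rw [h2]; abel]
  exact hyW

/-- A limit of the measures `ν_W^G(x_n)` determines the limit of the `x_n`, for an aperiodic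
window that is the closure of its interior. -/
theorem eq_of_mem_closure_graph (hG : InjOn Prod.fst (L : Set (G × H)))
    (hH : Dense (Prod.snd '' (L : Set (G × H)))) (hW : closure (interior (W : Set H)) = W)
    (hne : (interior (W : Set H)).Nonempty) (hap : IsAperiodicWindow (W : Set H))
    {x₁ x₂ : (G × H) ⧸ L}
    (h₁ : (x₁, ν) ∈ closure (nuWGGraph L W S)) (h₂ : (x₂, ν) ∈ closure (nuWGGraph L W S)) :
    x₁ = x₂ := by
  obtain ⟨z, rfl⟩ := QuotientAddGroup.mk_surjective x₁
  obtain ⟨_, hi, _, ⟨l, hl, rfl⟩, rfl⟩ :=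
    ((Homeomorph.addLeft z.2).surjective.denseRange.dense_image
      (continuous_const_add _) hH).inter_open_nonempty _ isOpen_interior hne
  have hz : (QuotientAddGroup.mk (z + l) : (G × H) ⧸ L) = QuotientAddGroup.mk z :=
    QuotientAddGroup.mk_add_of_mem z hl
  obtain ⟨y, ⟨rfl, -⟩, hfst⟩ := exists_mem_configSet_of_mem_closure_graph h₁ h₂ hz hi
  rw [← hz] at h₁ ⊢
  -- The reverse inclusion comes from exchanging the two base points.
  have hd : y.2 - (z + l).2 = 0 := by
    refine hap _ (Subset.antisymm ?_ fun w hw => ⟨(z + l).2 - y.2 + w, ?_, by beta_reduce; abel⟩)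
    · rintro _ ⟨w, hw, rfl⟩
      exact add_mem_window_of_mem_closure_graph hG hH hW hfst.symm h₁ h₂ hw
    · exact add_mem_window_of_mem_closure_graph hG hH hW hfst h₂ h₁ hw
  rw [Prod.ext hfst (sub_eq_zero.1 hd)]

theorem closure_graph_subset :
    closure (nuWGGraph L W S) ⊆ univ ×ˢ modelSpaceG L W := by
  refine closure_minimal ?_ (isClosed_univ.prod isClosed_closure)
  rintro _ ⟨x, -, rfl⟩
  exact ⟨trivial, subset_closure ⟨x, rfl⟩⟩

theorem isCompact_closure_graph [CompactSpace ((G × H) ⧸ L)] :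
    IsCompact (closure (nuWGGraph L W S)) :=
  (isCompact_univ.prod (isCompact_modelSpaceG L W)).of_isClosed_subset isClosed_closure
    closure_graph_subset

theorem image_snd_closure_graph [CompactSpace ((G × H) ⧸ L)] :
    Prod.snd '' closure (nuWGGraph L W S) = closure (nuWG L W '' S) := by
  rw [← (isClosedMap_snd_of_compactSpace (X := (G × H) ⧸ L)).closure_image_eq_of_continuous
    continuous_snd, nuWGGraph, image_image]

theorem shift_mem_closure_graph (hS : ∀ g, MapsTo (torusShift L g) S S)
    (h : (x, ν) ∈ closure (nuWGGraph L W S)) (g : G) :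
    (torusShift L g x, shiftMeasure g ν) ∈ closure (nuWGGraph L W S) := by
  refine map_mem_closure (f := Prod.map (torusShift L g) (shiftMeasure g))
    ((continuous_torusShift L g).prodMap (continuous_shiftMeasure g)) h ?_
  rintro _ ⟨x, hx, rfl⟩
  exact ⟨_, hS g hx, Prod.ext rfl (shiftMeasure_nuWG L W g x).symm⟩

/-! ### Minimality and the factor map -/

/-- The torus system `(X̂, T̂)` is minimal. -/
theorem eq_univ_of_torusShift_invariant (hH : Dense (Prod.snd '' (L : Set (G × H))))
    {A : Set ((G × H) ⧸ L)} (hne : A.Nonempty) (hA : IsClosed A)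
    (hinv : ∀ g, MapsTo (torusShift L g) A A) : A = univ := by
  obtain ⟨a, ha⟩ := hne
  obtain ⟨z, rfl⟩ := QuotientAddGroup.mk_surjective a
  refine eq_univ_of_forall fun x => ?_
  obtain ⟨w, rfl⟩ := QuotientAddGroup.mk_surjective x
  have hd : Dense ((fun h => z.2 + h) '' (Prod.snd '' (L : Set (G × H)))) :=
    (Homeomorph.addLeft z.2).surjective.denseRange.dense_image (continuous_const_add _) hH
  have hcl : IsClosed {h : H | (QuotientAddGroup.mk (w.1, h) : (G × H) ⧸ L) ∈ A} :=
    hA.preimage (QuotientAddGroup.continuous_mk.comp (Continuous.prodMk_right w.1))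
  have hsub : (fun h => z.2 + h) '' (Prod.snd '' (L : Set (G × H))) ⊆
      {h : H | (QuotientAddGroup.mk (w.1, h) : (G × H) ⧸ L) ∈ A} := by
    rintro _ ⟨_, ⟨l, hl, rfl⟩, rfl⟩
    -- This shift carries the representative z + l to the G-coordinate w.1 and leaves its
    -- H-coordinate unchanged.
    have h1 := hinv (w.1 - z.1 - l.1) ha
    rw [torusShift, ← QuotientAddGroup.mk_add, ← QuotientAddGroup.mk_add_of_mem _ hl] at h1
    have heq : ((w.1 - z.1 - l.1, 0) : G × H) + z + l = (w.1, z.2 + l.2) :=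
      Prod.ext (by simp only [Prod.fst_add]; abel) (by simp)
    rwa [heq] at h1
  exact closure_minimal hsub hcl (hd w.2)

theorem isSubsystem_closure_image_continuityPoints :
    IsSubsystem shiftMeasure (closure (nuWG L W '' continuityPoints L W)) where
  nonempty := by
    obtain ⟨x, hx⟩ := (dense_continuityPoints L W).nonempty
    exact ⟨_, subset_closure (mem_image_of_mem _ hx)⟩
  isClosed := isClosed_closure
  mapsTo g := by
    refine MapsTo.closure ?_ (continuous_shiftMeasure g)
    rintro _ ⟨x, hx, rfl⟩
    exact ⟨_, torusShift_mem_continuityPoints L W g hx, (shiftMeasure_nuWG L W g x).symm⟩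

theorem closure_image_continuityPoints_subset [CompactSpace ((G × H) ⧸ L)]
    (hH : Dense (Prod.snd '' (L : Set (G × H)))) {Y : Set (LFMeasure G)}
    (hYM : Y ⊆ modelSpaceG L W) (hY : IsSubsystem shiftMeasure Y) :
    closure (nuWG L W '' continuityPoints L W) ⊆ Y := by
  -- The graph over all of X̂ is needed, as elements of Y may be limits taken along discontinuity
  -- points.
  have hA : Prod.fst '' (closure (nuWGGraph L W univ) ∩ Prod.snd ⁻¹' Y) = univ := by
    refine eq_univ_of_torusShift_invariant hH ?_ ?_ ?_
    · obtain ⟨ν, hν⟩ := hY.nonempty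
      have h := hYM hν
      rw [modelSpaceG, ← image_univ, ← image_snd_closure_graph] at h
      obtain ⟨p, hp, rfl⟩ := h
      exact ⟨_, p, ⟨hp, hν⟩, rfl⟩
    · exact ((isCompact_closure_graph.inter_right (hY.isClosed.preimage continuous_snd)).image
        continuous_fst).isClosed
    · rintro g _ ⟨⟨x, ν⟩, ⟨hx, hν⟩, rfl⟩
      exact ⟨_, ⟨shift_mem_closure_graph (fun _ => mapsTo_univ _ _) hx g, hY.mapsTo g hν⟩, rfl⟩
  refine closure_minimal ?_ hY.isClosed
  rintro _ ⟨x, hx, rfl⟩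
  obtain ⟨⟨_, ν⟩, ⟨h, hν⟩, rfl⟩ := hA.symm ▸ mem_univ x
  rw [← eq_nuWG_of_mem_closure_graph h hx]
  exact hν

theorem closure_image_regularPart :
    closure (nuWG L (regularPart W) '' continuityPoints L (regularPart W)) =
      closure (nuWG L W '' continuityPoints L W) := by
  have hcongr : nuWG L W '' continuityPoints L W =
      nuWG L (regularPart W) '' continuityPoints L W :=
    image_congr fun x hx => (nuWG_regularPart L W hx).symm
  rw [hcongr]
  refine Subset.antisymm (closure_minimal ?_ isClosed_closure)
    (closure_mono (image_mono (continuityPoints_subset_regularPart L W)))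
  rintro _ ⟨x, hx, rfl⟩
  -- C_W may be smaller than C_{W'}, but it is dense and the W'-map is continuous at x̂.
  exact (continuousAt_nuWG L _ hx).continuousWithinAt.mem_closure_image
    (dense_continuityPoints L W x)

theorem isMinimalSubsystem_closure_image [CompactSpace ((G × H) ⧸ L)]
    (hH : Dense (Prod.snd '' (L : Set (G × H)))) :
    IsMinimalSubsystem shiftMeasure (closure (nuWG L W '' continuityPoints L W)) where
  isSubsystem := isSubsystem_closure_image_continuityPoints
  eq_of_subset _ hY' hY := hY'.antisymm (closure_image_continuityPoints_subset hH
    (hY'.trans (closure_mono (image_subset_range _ _))) hY)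

theorem exists_isAlmostAutomorphicExtension [CompactSpace ((G × H) ⧸ L)]
    (hG : InjOn Prod.fst (L : Set (G × H)))
    (hH : Dense (Prod.snd '' (L : Set (G × H))))
    (hW : (interior (W : Set H)).Nonempty)
    (hW' : IsAperiodicWindow (regularPart W : Set H)) :
    ∃ π : LFMeasure G → (G × H) ⧸ L,
      IsAlmostAutomorphicExtension shiftMeasure (closure (nuWG L W '' continuityPoints L W))
        (torusShift L) π ∧
      ∀ x ∈ continuityPoints L W, π (nuWG L W x) = x := by
  classical
  set Γ := closure (nuWGGraph L W (continuityPoints L W)) with hΓ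
  have hΓM : Prod.snd '' Γ = closure (nuWG L W '' continuityPoints L W) := image_snd_closure_graph
  have huniq : ∀ {x₁ x₂ ν}, (x₁, ν) ∈ Γ → (x₂, ν) ∈ Γ → x₁ = x₂ := by
    intro x₁ x₂ ν h₁ h₂
    have hcongr : nuWGGraph L W (continuityPoints L W) =
        nuWGGraph L (regularPart W) (continuityPoints L W) :=
      image_congr fun x hx => by rw [nuWG_regularPart L W hx]
    rw [hΓ, hcongr] at h₁ h₂
    refine eq_of_mem_closure_graph hG hH ?_ ?_ hW' h₁ h₂
    · rw [interior_regularPart]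
      rfl
    · rwa [interior_regularPart]
  choose! π hπ using fun (ν : LFMeasure G) (h : ν ∈ Prod.snd '' Γ) =>
    show ∃ x, (x, ν) ∈ Γ by
      obtain ⟨⟨x, _⟩, hx, rfl⟩ := h
      exact ⟨x, hx⟩
  have hmem : ∀ {x ν}, (x, ν) ∈ Γ → π ν = x := fun {x ν} h => huniq (hπ ν ⟨_, h, rfl⟩) h
  have hgraph : ∀ x ∈ continuityPoints L W, (x, nuWG L W x) ∈ Γ := fun x hx =>
    subset_closure ⟨x, hx, rfl⟩
  refine ⟨π, ?_, fun x hx => hmem (hgraph x hx)⟩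
  rw [← hΓM]
  refine ⟨isCompact_closure_graph.image continuous_snd, ?_, ?_, ?_, ?_, ?_⟩
  · rw [hΓM]
    exact isMinimalSubsystem_closure_image hH
  -- Closed graph argument: Γ is the graph of π on M, and projection along the compact X̂ is closed.
  · refine continuousOn_iff_isClosed.2 fun C hC => ⟨Prod.snd '' (Γ ∩ Prod.fst ⁻¹' C), ?_, ?_⟩
    · exact isClosedMap_snd_of_compactSpace _
        (isClosed_closure.inter (hC.preimage continuous_fst))
    · ext ν
      constructor
      · rintro ⟨hC, hν⟩
        exact ⟨⟨(π ν, ν), ⟨hπ ν hν, hC⟩, rfl⟩, hν⟩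
      · rintro ⟨⟨⟨x, _⟩, ⟨hx, hxC⟩, rfl⟩, hν⟩
        exact ⟨by rw [mem_preimage, hmem hx]; exact hxC, hν⟩
  · have hcl : IsClosed (Prod.fst '' Γ) := (isCompact_closure_graph.image continuous_fst).isClosed
    have hsub : continuityPoints L W ⊆ Prod.fst '' Γ := fun x hx => ⟨_, hgraph x hx, rfl⟩
    intro x _
    obtain ⟨⟨_, ν⟩, hx, rfl⟩ := closure_minimal hsub hcl (dense_continuityPoints L W x)
    exact ⟨ν, ⟨_, hx, rfl⟩, hmem hx⟩
  · intro g ν hν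
    exact hmem (shift_mem_closure_graph
      (fun g x hx => torusShift_mem_continuityPoints L W g hx) (hπ ν hν) g)
  · refine ⟨_, isGδ_continuityPoints L W, dense_continuityPoints L W, fun x hx => ?_⟩
    refine ⟨nuWG L W x, ⟨⟨_, hgraph x hx, rfl⟩, hmem (hgraph x hx)⟩, ?_⟩
    rintro ν ⟨hν, rfl⟩
    exact eq_nuWG_of_mem_closure_graph (hπ ν hν) hx

end Dynamics

theorem mainTheorem12
    {G H : Type*}
    [AddCommGroup G] [TopologicalSpace G] [IsTopologicalAddGroup G] [LocallyCompactSpace G]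
    [T2Space G] [SecondCountableTopology G] [MeasurableSpace G] [BorelSpace G]
    [AddCommGroup H] [TopologicalSpace H] [IsTopologicalAddGroup H] [LocallyCompactSpace H]
    [T2Space H] [SecondCountableTopology H] [MeasurableSpace H] [BorelSpace H]
    (L : AddSubgroup (G × H)) [DiscreteTopology L] [CompactSpace ((G × H) ⧸ L)]
    (hG : InjOn Prod.fst (L : Set (G × H)))
    (hH : Dense (Prod.snd '' (L : Set (G × H))))
    (W : Compacts H)
    (hW : (interior (W : Set H)).Nonempty)
    (hW' : IsAperiodicWindow (regularPart W : Set H)) :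
    closure (nuWG L (regularPart W) '' continuityPoints L (regularPart W)) =
        closure (nuWG L W '' continuityPoints L W) ∧
      closure (nuWG L W '' continuityPoints L W) ⊆ modelSpaceG L W ∧
      (∃ π : LFMeasure G → (G × H) ⧸ L,
        IsAlmostAutomorphicExtension shiftMeasure (closure (nuWG L W '' continuityPoints L W))
          (torusShift L) π ∧
        ∀ x ∈ continuityPoints L W, π (nuWG L W x) = x) ∧
      ∀ Y ⊆ modelSpaceG L W,
        IsMinimalSubsystem shiftMeasure Y ↔ Y = closure (nuWG L W '' continuityPoints L W) := by
  refine ⟨closure_image_regularPart, closure_mono (image_subset_range _ _),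
    exists_isAlmostAutomorphicExtension hG hH hW hW', fun Y hY => ⟨fun h => ?_, ?_⟩⟩
  · exact (h.eq_of_subset _ (closure_image_continuityPoints_subset hH hY h.isSubsystem)
      isSubsystem_closure_image_continuityPoints).symm
  · rintro rfl
    exact isMinimalSubsystem_closure_image hH
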